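/- All Banach spaces are real. For a Banach space $X\neq\{0\}$ let $B_X$ and $S_X$ be its closed unit ball and unit sphere, and let $B(x,r)$ be the closed ball with centre $x$ and radius $r$. A slice of $B_X$ is a set $\{x\in B_X: x^*(x)>1-\alpha\}$ with $x^*\in S_{X^*}$, $\alpha>0$; a weak$^*$ slice of $B_{X^*}$ is a set $\{x^*\in B_{X^*}: x^*(x)>1-\alpha\}$ with $x\in S_X$, $\alpha>0$. Define \begin{align*} \mathcal T(X)&=\inf\{r>0:\ \exists\,x\in S_X,\ \exists\,W\text{ relatively weakly open in }B_X,\ \emptyset\ne W\subset B(x,r)\},\\ \mathcal T^s(X)&=\inf\{r>0:\ \exists\,x\in S_X,\ \exists\,S\text{ slice of }B_X,\ S\subset B(x,r)\},\\ \mathcal T_{w^*}(X^*)&=\inf\{r>0:\ \exists\,x^*\in S_{X^*},\ \exists\,W\text{ relatively weak}^*\text{ open in }B_{X^*},\ \emptyset\ne W\subset B(x^*,r)\},\\ \mathcal T^s_{w^*}(X^*)&=\inf\{r>0:\ \exists\,x^*\in S_{X^*},\ \exists\,S\text{ weak}^*\text{ slice of }B_{X^*},\ S\subset B(x^*,r)\}.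 \end{align*} A bounded linear operator is weakly compact if it maps the closed unit ball to a relatively weakly compact set. Let $I$ denote the identity operator. (a) For every Banach space $X$ and every weakly compact operator $T\colon X\to X$ with $\|T\|=1$, $$\|T+I\|\ \ge\ \max\{\mathcal T^s(X),\ \mathcal T^s_{w^*}(X^*)\}.$$ (b) The equality $$\inf\{\|T+I\|:\ T\colon X\to X\text{ bounded linear and weakly compact},\ \|T\|=1\}=\max\{\mathcal T(X),\ \mathcal T_{w^*}(X^*)\}$$ does not hold for every Banach space $X$: there is a Banach space $Z$ that is linearly homeomorphic to $c_0$ (that is, an equivalent renorming of $c_0$) for which it fails. -/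

import Mathlib

open scoped ZeroAtInfty

noncomputable section

namespace DaugavetIndex

section Space

variable (X : Type*) [NormedAddCommGroup X] [NormedSpace ℝ X]

/-- The slice `S(B_X, f, α) = {x ∈ B_X : f x > 1 - α}` of the closed unit ball
(used with `‖f‖ = 1` and `α > 0`). -/
def slice (f : StrongDual ℝ X) (α : ℝ) : Set X :=
  {x | x ∈ Metric.closedBall (0 : X) 1 ∧ 1 - α < f x}

/-- `S` is a slice of the closed unit ball of `X`. -/
def IsSlice (S : Set X) : Prop :=
  ∃ (f : StrongDual ℝ X) (α : ℝ), ‖f‖ = 1 ∧ 0 < α ∧ S = slice X f α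

/-- `W` is a relatively weakly open subset of the closed unit ball of `X`. -/
def IsRelWeaklyOpen (W : Set X) : Prop :=
  ∃ U : Set (WeakSpace ℝ X), IsOpen U ∧
    W = Metric.closedBall (0 : X) 1 ∩ toWeakSpace ℝ X ⁻¹' U

/-- The weak-star slice `{f ∈ B_{X*} : f x > 1 - α}` of the closed unit ball of the dual
(used with `‖x‖ = 1` and `α > 0`). -/
def weakStarSlice (x : X) (α : ℝ) : Set (StrongDual ℝ X) :=
  {f | f ∈ Metric.closedBall (0 : StrongDual ℝ X) 1 ∧ 1 - α < f x}

/-- `S` is a weak-star slice of the closed unit ball of the dual of `X`. -/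
def IsWeakStarSlice (S : Set (StrongDual ℝ X)) : Prop :=
  ∃ (x : X) (α : ℝ), ‖x‖ = 1 ∧ 0 < α ∧ S = weakStarSlice X x α

/-- `W` is a relatively weak-star open subset of the closed unit ball of the dual of `X`. -/
def IsRelWeakStarOpen (W : Set (StrongDual ℝ X)) : Prop :=
  ∃ U : Set (WeakDual ℝ X), IsOpen U ∧
    W = Metric.closedBall (0 : StrongDual ℝ X) 1 ∩ StrongDual.toWeakDual ⁻¹' U

/-- The Daugavet index of thickness `𝒯(X)`. For `X ≠ 0` the set below is nonempty (it contains
`2`) and bounded below by `0`; the same holds for the three indices that follow. -/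
def index : ℝ :=
  sInf {r : ℝ | 0 < r ∧ ∃ x : X, ‖x‖ = 1 ∧ ∃ W : Set X,
    IsRelWeaklyOpen X W ∧ W.Nonempty ∧ W ⊆ Metric.closedBall x r}

/-- The slice version `𝒯ˢ(X)` of the Daugavet index of thickness. -/
def sliceIndex : ℝ :=
  sInf {r : ℝ | 0 < r ∧ ∃ x : X, ‖x‖ = 1 ∧ ∃ S : Set X,
    IsSlice X S ∧ S ⊆ Metric.closedBall x r}

/-- The weak-star index `𝒯_{w*}(X*)` of the dual of `X`. The argument is the predual `X`. -/
def weakStarIndex : ℝ :=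
  sInf {r : ℝ | 0 < r ∧ ∃ f : StrongDual ℝ X, ‖f‖ = 1 ∧ ∃ W : Set (StrongDual ℝ X),
    IsRelWeakStarOpen X W ∧ W.Nonempty ∧ W ⊆ Metric.closedBall f r}

/-- The weak-star slice index `𝒯ˢ_{w*}(X*)` of the dual of `X`. The argument is the predual
`X`. -/
def weakStarSliceIndex : ℝ :=
  sInf {r : ℝ | 0 < r ∧ ∃ f : StrongDual ℝ X, ‖f‖ = 1 ∧ ∃ S : Set (StrongDual ℝ X),
    IsWeakStarSlice X S ∧ S ⊆ Metric.closedBall f r}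

end Space

/-- A bounded operator is weakly compact if the image of the closed unit ball is relatively
compact in the weak topology. -/
def IsWeaklyCompact {X Y : Type*} [NormedAddCommGroup X] [NormedSpace ℝ X]
    [NormedAddCommGroup Y] [NormedSpace ℝ Y] (T : X →L[ℝ] Y) : Prop :=
  IsCompact (closure (toWeakSpace ℝ Y '' (T '' Metric.closedBall (0 : X) 1)))

end DaugavetIndex

end

namespace DaugavetIndex

open Set Filter Topology TopologicalSpace

/-! ### Dentability of weakly compact sets -/

section Dentability

variable {Y : Type*} [NormedAddCommGroup Y] [NormedSpace ℝ Y]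

/-! Part (a) rests on dentability: in a weakly compact set, every half space that meets the set
contains a slice of small diameter (`exists_small_slice`). Apply this to the weak closure of T(B_X)
and to a half space where a norm-one functional exceeds 1 - δ. The small slice {g > a} pulls back
along T to a slice of B_X on which T is nearly constant, with value close to some Tw of norm nearly
1. For y in it, y + Tw/‖Tw‖ is close to y + Ty, so the slice lies in a ball of radius about ‖T + I‖
centred at -Tw/‖Tw‖ (`exists_slice_subset_closedBall`). The dual index follows from the same lemma
for the adjoint: T** takes values in X, so T* is weak*-to-weak continuous, and pulled-back slices
are weak* slices.

For (b), part (a) shows that it suffices to find Z whose slice index exceeds both weak-topology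
indices. Renorm c₀ by the convex hull of two faces of the cube, each free only on coordinate 0 and
one parity, together with 4/5 of the cube. Every slice contains a generator, and a generator keeps a
far coordinate that may be raised to at least 4/5, so the slice index is at least 4/5
(`le_sliceIndex`). A weak neighbourhood can instead isolate a midpoint of two generators of opposite
parity, where all far coordinates are forced down to about 1/2 (`index_le`). In the dual, a
functional of extremal ℓ₁ norm has small weak* neighbourhoods (`weakStarIndex_le`). Both weak
indices are thus at most 7/10. -/

theorem continuous_apply_toWeakSpace_symm (g : StrongDual ℝ Y) :
    Continuous fun z : WeakSpace ℝ Y => g ((toWeakSpace ℝ Y).symm z) :=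
  WeakBilin.eval_continuous (topDualPairing ℝ Y).flip g

theorem isClosed_preimage_toWeakSpace_symm {C : Set Y} (hC : Convex ℝ C) (hC' : IsClosed C) :
    IsClosed ((toWeakSpace ℝ Y).symm ⁻¹' C) := by
  have h := hC.toWeakSpace_closure ℝ
  rw [hC'.closure_eq, LinearEquiv.image_eq_preimage_symm] at h
  rw [h]
  exact isClosed_closure

/-- Every continuous functional is dominated on `K` by its values on `F`. -/
def Dominates (F K : Set (WeakSpace ℝ Y)) : Prop :=
  ∀ g : StrongDual ℝ Y, ∀ k ∈ K, ∃ x ∈ F,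
    g ((toWeakSpace ℝ Y).symm k) ≤ g ((toWeakSpace ℝ Y).symm x)

/-- By Hahn–Banach, domination places K in the closed convex hull of F, so closed convex conditions
transfer from F to K. -/
theorem Dominates.mem_of_convex {F K : Set (WeakSpace ℝ Y)} (h : Dominates F K) {C : Set Y}
    (hC : Convex ℝ C) (hC' : IsClosed C) (hF : ∀ x ∈ F, (toWeakSpace ℝ Y).symm x ∈ C)
    {k : WeakSpace ℝ Y} (hk : k ∈ K) : (toWeakSpace ℝ Y).symm k ∈ C := by
  by_contra hkC
  obtain ⟨g, u, hu, hgu⟩ := geometric_hahn_banach_closed_point hC hC' hkC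
  obtain ⟨x, hx, hxk⟩ := h g k hk
  linarith [hu _ (hF x hx)]

/-- A weakly compact set contains a minimal weakly compact dominating subset. -/
theorem exists_minimal_dominates {K : Set (WeakSpace ℝ Y)} (hK : IsCompact K) :
    ∃ F ⊆ K, IsCompact F ∧ Dominates F K ∧
      ∀ F' ⊆ F, IsCompact F' → Dominates F' K → F' = F := by
  have hlb : ∀ c ⊆ {F : Set (WeakSpace ℝ Y) | F ⊆ K ∧ IsCompact F ∧ Dominates F K},
      IsChain (· ⊆ ·) c → c.Nonempty →
      ∃ lb ∈ {F : Set (WeakSpace ℝ Y) | F ⊆ K ∧ IsCompact F ∧ Dominates F K},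
        ∀ s ∈ c, lb ⊆ s := by
    intro c hc hchain hne
    have hcl : ∀ F ∈ c, IsClosed F := fun F hF => (hc hF).2.1.isClosed
    refine ⟨⋂₀ c, ⟨?_, ?_, ?_⟩, fun s hs => sInter_subset_of_mem hs⟩
    · obtain ⟨F, hF⟩ := hne
      exact (sInter_subset_of_mem hF).trans (hc hF).1
    · exact hK.of_isClosed_subset (isClosed_sInter hcl) (by
        obtain ⟨F, hF⟩ := hne
        exact (sInter_subset_of_mem hF).trans (hc hF).1)
    · intro g k hk
      have hclosed : IsClosed {x : WeakSpace ℝ Y |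
          g ((toWeakSpace ℝ Y).symm k) ≤ g ((toWeakSpace ℝ Y).symm x)} :=
        isClosed_le continuous_const (continuous_apply_toWeakSpace_symm g)
      have := hne.to_subtype
      -- Each member of the chain meets this weakly closed half space in a compact set, so by
      -- compactness the intersection of the chain meets it too.
      set Φ : c → Set (WeakSpace ℝ Y) := fun F => (F : Set (WeakSpace ℝ Y)) ∩
        {x | g ((toWeakSpace ℝ Y).symm k) ≤ g ((toWeakSpace ℝ Y).symm x)} with hΦ
      have hdir : Directed (· ⊇ ·) Φ := by
        intro F G
        rcases hchain.total F.2 G.2 with h | h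
        · exact ⟨F, subset_rfl, inter_subset_inter_left _ h⟩
        · exact ⟨G, inter_subset_inter_left _ h, subset_rfl⟩
      have hΦne : ∀ F, (Φ F).Nonempty := fun F => by
        obtain ⟨x, hx, hx'⟩ := (hc F.2).2.2 g k hk
        exact ⟨x, hx, hx'⟩
      obtain ⟨x, hx⟩ := IsCompact.nonempty_iInter_of_directed_nonempty_isCompact_isClosed
        Φ hdir hΦne (fun F => (hc F.2).2.1.inter_right hclosed)
        (fun F => (hcl F F.2).inter hclosed)
      rw [mem_iInter] at hx
      refine ⟨x, mem_sInter.2 fun F hF => (hx ⟨F, hF⟩).1, ?_⟩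
      obtain ⟨F, hF⟩ := hne
      exact (hx ⟨F, hF⟩).2
  obtain ⟨F, hFK, hF⟩ := zorn_superset_nonempty _ hlb K
    ⟨subset_rfl, hK, fun g k hk => ⟨k, hk, le_rfl⟩⟩
  refine ⟨F, hFK, hF.prop.2.1, hF.prop.2.2, fun F' hF' hc hd => ?_⟩
  exact subset_antisymm hF' (hF.le_of_le ⟨hF'.trans hFK, hc, hd⟩ hF')

/-- In a norm separable weakly compact set, every half space meeting the set contains a slice of
the set of small diameter. -/
theorem exists_small_slice_of_isSeparable {K : Set (WeakSpace ℝ Y)} (hK : IsCompact K) {R : ℝ}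
    (hR : ∀ x ∈ K, ‖(toWeakSpace ℝ Y).symm x‖ ≤ R)
    (hsep : IsSeparable ((toWeakSpace ℝ Y).symm '' K)) (f : StrongDual ℝ Y) {c : ℝ}
    {x₀ : WeakSpace ℝ Y} (hx₀ : x₀ ∈ K) (hc : c < f ((toWeakSpace ℝ Y).symm x₀))
    {ε : ℝ} (hε : 0 < ε) :
    ∃ (g : StrongDual ℝ Y) (a : ℝ) (d : Y), (∃ x ∈ K, a < g ((toWeakSpace ℝ Y).symm x)) ∧
      ∀ x ∈ K, a < g ((toWeakSpace ℝ Y).symm x) →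
        c < f ((toWeakSpace ℝ Y).symm x) ∧ ‖(toWeakSpace ℝ Y).symm x - d‖ ≤ ε := by
  obtain ⟨F, hFK, hF, hdom, hmin⟩ := exists_minimal_dominates hK
  obtain ⟨c', hcc', hc'⟩ := exists_between hc
  obtain ⟨D, hD, hKD⟩ := hsep
  -- a relatively weakly open piece of `F` of small diameter inside the half space
  obtain ⟨V, hV, ⟨v, hvF, hvV⟩, d, hd⟩ : ∃ V : Set (WeakSpace ℝ Y), IsOpen V ∧ (F ∩ V).Nonempty ∧
      ∃ d : Y, ∀ z ∈ F ∩ V, ‖(toWeakSpace ℝ Y).symm z - d‖ ≤ ε / 2 ∧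
        c' ≤ f ((toWeakSpace ℝ Y).symm z) := by
    have : CompactSpace F := isCompact_iff_compactSpace.1 hF
    have : Countable D := hD.to_subtype
    -- Baire category in the compact set F: norm balls are weakly closed, and those of radius ε/2
    -- about the countable set D cover F.
    let S : Option D → Set F := fun i => i.elim
      {z | f ((toWeakSpace ℝ Y).symm z) ≤ c'}
      (fun d => {z | (toWeakSpace ℝ Y).symm z ∈ Metric.closedBall (d : Y) (ε / 2)})
    have hSc : ∀ i, IsClosed (S i) := by
      rintro (_ | d)
      · exact isClosed_le ((continuous_apply_toWeakSpace_symm f).comp continuous_subtype_val)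
          continuous_const
      · exact (isClosed_preimage_toWeakSpace_symm (convex_closedBall _ _)
          Metric.isClosed_closedBall).preimage continuous_subtype_val
    have hSU : ⋃ i, S i = univ := by
      refine eq_univ_of_forall fun z => ?_
      obtain ⟨d, hdD, hd⟩ := Metric.mem_closure_iff.1 (hKD (mem_image_of_mem _ (hFK z.2))) (ε / 2)
        (half_pos hε)
      exact mem_iUnion.2 ⟨some ⟨d, hdD⟩, hd.le⟩
    have hdense := dense_iUnion_interior_of_closed hSc hSU
    obtain ⟨x₁, hx₁, hx₁'⟩ := hdom f x₀ hx₀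
    have hO : IsOpen {z : F | c' < f ((toWeakSpace ℝ Y).symm z)} :=
      isOpen_lt continuous_const
        ((continuous_apply_toWeakSpace_symm f).comp continuous_subtype_val)
    obtain ⟨z, hzO, hz⟩ := hdense.inter_open_nonempty _ hO ⟨⟨x₁, hx₁⟩, hc'.trans_le hx₁'⟩
    obtain ⟨i, hi⟩ := mem_iUnion.1 hz
    rcases i with _ | d
    · have h2 : z ∈ S none := interior_subset hi
      exact absurd hzO (not_lt.2 (show f ((toWeakSpace ℝ Y).symm z) ≤ c' from h2))
    · obtain ⟨V, hV, hVeq⟩ := isOpen_induced_iff.1 (isOpen_interior.inter hO :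
        IsOpen (interior (S (some d)) ∩ {z : F | c' < f ((toWeakSpace ℝ Y).symm z)}))
      refine ⟨V, hV, ⟨z, z.2, ?_⟩, d, fun y hy => ?_⟩
      · have : z ∈ Subtype.val ⁻¹' V := by rw [hVeq]; exact ⟨hi, hzO⟩
        exact this
      · have : (⟨y, hy.1⟩ : F) ∈ Subtype.val ⁻¹' V := hy.2
        rw [hVeq] at this
        refine ⟨?_, le_of_lt this.2⟩
        have h2 : (⟨y, hy.1⟩ : F) ∈ S (some d) := interior_subset this.1
        exact mem_closedBall_iff_norm.1 h2
  -- by minimality some functional is strictly smaller on the rest of `F`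
  obtain ⟨g, k, hk, hgk⟩ : ∃ g : StrongDual ℝ Y, ∃ k ∈ K, ∀ x ∈ F \ V,
      g ((toWeakSpace ℝ Y).symm x) < g ((toWeakSpace ℝ Y).symm k) := by
    have hnd : ¬ Dominates (F \ V) K := fun h => by
      have := hmin _ sdiff_subset (hF.diff hV) h
      exact (this.symm.subset hvF).2 hvV
    simpa only [Dominates, not_forall, not_exists, not_and, not_le, exists_prop] using hnd
  obtain ⟨xM, hxM, hM⟩ := hF.exists_isMaxOn ⟨v, hvF⟩
    (continuous_apply_toWeakSpace_symm g).continuousOn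
  set M := g ((toWeakSpace ℝ Y).symm xM) with hMdef
  have hM' : ∀ x ∈ F, g ((toWeakSpace ℝ Y).symm x) ≤ M := fun x hx => hM hx
  obtain ⟨a₀, ha₀M, ha₀⟩ : ∃ a₀ < M, ∀ x ∈ F \ V, g ((toWeakSpace ℝ Y).symm x) ≤ a₀ := by
    rcases (F \ V).eq_empty_or_nonempty with h | h
    · exact ⟨M - 1, by linarith, by simp [h]⟩
    · obtain ⟨x₁, hx₁, hx₁'⟩ := (hF.diff hV).exists_isMaxOn h
        (continuous_apply_toWeakSpace_symm g).continuousOn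
      obtain ⟨x₂, hx₂, hx₂'⟩ := hdom g k hk
      exact ⟨_, ((hgk _ hx₁).trans_le hx₂').trans_le (hM' _ hx₂), fun x hx => hx₁' hx⟩
  have hR0 : 0 ≤ R := (norm_nonneg _).trans (hR x₀ hx₀)
  have hgap : 0 < M - a₀ := sub_pos.2 ha₀M
  -- N bounds both ‖y - d‖ and c' - f y on K, and κ is chosen so that the penalty κ(M - g) is at
  -- least N off V. The two estimates below then hold on all of F, and pass to K by domination.
  set N := R + ‖d‖ + ‖f‖ * R + |c'| with hN
  have hN0 : 0 ≤ N := by positivity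
  set κ := N / (M - a₀) with hκ
  have hκ0 : 0 ≤ κ := by positivity
  have hκN : ∀ x ∈ F \ V, N ≤ κ * (M - g ((toWeakSpace ℝ Y).symm x)) := fun x hx => by
    calc N = κ * (M - a₀) := by rw [hκ]; field_simp
      _ ≤ _ := mul_le_mul_of_nonneg_left (by linarith [ha₀ x hx]) hκ0
  have hκM : ∀ x ∈ F, 0 ≤ κ * (M - g ((toWeakSpace ℝ Y).symm x)) := fun x hx =>
    mul_nonneg hκ0 (by linarith [hM' x hx])
  have hball : ∀ x ∈ K, ‖(toWeakSpace ℝ Y).symm x - d‖ +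
      κ * g ((toWeakSpace ℝ Y).symm x) ≤ ε / 2 + κ * M := by
    intro x hx
    refine hdom.mem_of_convex (C := {y : Y | ‖y - d‖ + κ * g y ≤ ε / 2 + κ * M}) ?_ ?_ ?_ hx
    · have h1 : ConvexOn ℝ univ fun y : Y => ‖y - d‖ := by
        have := (convexOn_univ_norm (E := Y)).translate_left (-d)
        simpa [Function.comp_def, sub_eq_add_neg] using this
      have h2 : ConvexOn ℝ univ fun y : Y => κ * g y :=
        ((κ • g : StrongDual ℝ Y) : Y →ₗ[ℝ] ℝ).convexOn convex_univ
      simpa using (h1.add h2).convex_le (ε / 2 + κ * M)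
    · exact isClosed_le (by fun_prop) continuous_const
    · intro z hz
      by_cases hzV : z ∈ V
      · have := (hd z ⟨hz, hzV⟩).1
        have := hκM z hz
        simp only [mem_ofPred_eq]; linarith
      · have h1 := hκN z ⟨hz, hzV⟩
        have h2 := norm_sub_le ((toWeakSpace ℝ Y).symm z) d
        have h3 := hR z (hFK hz)
        have h4 : 0 ≤ ‖f‖ * R := by positivity
        have h5 := abs_nonneg c'
        simp only [mem_ofPred_eq]; linarith
  have hhalf : ∀ x ∈ K, c' - κ * (M - g ((toWeakSpace ℝ Y).symm x)) ≤
      f ((toWeakSpace ℝ Y).symm x) := by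
    intro x hx
    obtain ⟨z, hz, hz'⟩ := hdom (κ • g - f) x hx
    simp only [sub_apply, smul_apply, smul_eq_mul] at hz'
    have : κ * g ((toWeakSpace ℝ Y).symm z) - f ((toWeakSpace ℝ Y).symm z) ≤ κ * M - c' := by
      by_cases hzV : z ∈ V
      · have := (hd z ⟨hz, hzV⟩).2
        have := hκM z hz
        linarith
      · have h1 := hκN z ⟨hz, hzV⟩
        have h2 : -f ((toWeakSpace ℝ Y).symm z) ≤ ‖f‖ * R :=
          (neg_le_abs _).trans ((f.le_opNorm _).trans
            (mul_le_mul_of_nonneg_left (hR z (hFK hz)) (norm_nonneg _)))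
        have h4 : 0 ≤ ‖d‖ := by positivity
        have h5 := le_abs_self c'
        linarith
    linarith
  -- On {g > M - τ} the penalty is below m, which leaves norm error at most ε and keeps f above c.
  set m := min (ε / 2) (c' - c) with hm
  have hm0 : 0 < m := lt_min (half_pos hε) (sub_pos.2 hcc')
  set τ := m / (κ + 1) with hτ
  have hτ0 : 0 < τ := by positivity
  have hκτ : κ * τ < m := by
    have : (κ + 1) * τ = m := by rw [hτ]; field_simp
    linarith
  refine ⟨g, M - τ, d, ⟨xM, hFK hxM, by linarith⟩, fun x hx hax => ?_⟩
  have h1 : κ * (M - g ((toWeakSpace ℝ Y).symm x)) ≤ κ * τ :=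
    mul_le_mul_of_nonneg_left (by linarith) hκ0
  have h2 := hball x hx
  have h3 := hhalf x hx
  have h4 := min_le_left (ε / 2) (c' - c)
  have h5 := min_le_right (ε / 2) (c' - c)
  constructor <;> linarith

/-- Every half space meeting a bounded weakly compact set contains a slice of the set of small
diameter. -/
theorem exists_small_slice {K : Set (WeakSpace ℝ Y)} (hK : IsCompact K) {R : ℝ}
    (hR : ∀ x ∈ K, ‖(toWeakSpace ℝ Y).symm x‖ ≤ R) (f : StrongDual ℝ Y) {c : ℝ}
    {x₀ : WeakSpace ℝ Y} (hx₀ : x₀ ∈ K) (hc : c < f ((toWeakSpace ℝ Y).symm x₀))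
    {ε : ℝ} (hε : 0 < ε) :
    ∃ (g : StrongDual ℝ Y) (a : ℝ) (d : Y), (∃ x ∈ K, a < g ((toWeakSpace ℝ Y).symm x)) ∧
      ∀ x ∈ K, a < g ((toWeakSpace ℝ Y).symm x) →
        c < f ((toWeakSpace ℝ Y).symm x) ∧ ‖(toWeakSpace ℝ Y).symm x - d‖ ≤ ε := by
  by_contra hno
  -- a point of the half space is in the closed convex hull of a countable part of `K` away from it
  have hstep : ∀ x : WeakSpace ℝ Y, ∃ A ⊆ K, A.Countable ∧
      (x ∈ K → c < f ((toWeakSpace ℝ Y).symm x) →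
        (∀ y ∈ A, c < f ((toWeakSpace ℝ Y).symm y) →
          ε < ‖(toWeakSpace ℝ Y).symm y - (toWeakSpace ℝ Y).symm x‖) ∧
        ∀ (g : StrongDual ℝ Y) (a : ℝ), (∀ y ∈ A, g ((toWeakSpace ℝ Y).symm y) ≤ a) →
          g ((toWeakSpace ℝ Y).symm x) ≤ a) := by
    intro x
    by_cases hx : x ∈ K ∧ c < f ((toWeakSpace ℝ Y).symm x)
    swap
    · exact ⟨∅, empty_subset _, countable_empty, fun h h' => absurd ⟨h, h'⟩ hx⟩
    -- If x were outside the closed convex hull of s, a separating functional would cut from K a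
    -- slice inside the half space and within ε of x.
    set s : Set Y := {y | toWeakSpace ℝ Y y ∈ K ∧
      (c < f y → ε < ‖y - (toWeakSpace ℝ Y).symm x‖)} with hs
    have hmem : (toWeakSpace ℝ Y).symm x ∈ closure (convexHull ℝ s) := by
      by_contra hxs
      obtain ⟨g, u, hu, hgu⟩ := geometric_hahn_banach_closed_point (convex_convexHull ℝ s).closure
        isClosed_closure hxs
      refine hno ⟨g, u, (toWeakSpace ℝ Y).symm x, ⟨x, hx.1, hgu⟩, fun y hy hyu => ?_⟩
      by_contra hcon
      have : (toWeakSpace ℝ Y).symm y ∈ s := by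
        refine ⟨by simpa using hy, fun h => ?_⟩
        by_contra h'
        exact hcon ⟨h, not_lt.1 h'⟩
      linarith [hu _ (subset_closure (subset_convexHull ℝ s this))]
    obtain ⟨u, hus, hux⟩ := mem_closure_iff_seq_limit.1 hmem
    have hfin : ∀ n, ∃ t : Finset Y, (t : Set Y) ⊆ s ∧ u n ∈ convexHull ℝ (t : Set Y) := by
      intro n
      have := hus n
      rw [convexHull_eq_union_convexHull_finite_subsets] at this
      simpa using this
    choose t hts htu using hfin
    refine ⟨toWeakSpace ℝ Y '' ⋃ n, (t n : Set Y), ?_, ?_, fun _ _ => ⟨?_, ?_⟩⟩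
    · rintro _ ⟨y, hy, rfl⟩
      obtain ⟨n, hn⟩ := mem_iUnion.1 hy
      exact (hts n hn).1
    · exact (countable_iUnion fun n => (t n).countable_toSet).image _
    · rintro _ ⟨y, hy, rfl⟩ h
      obtain ⟨n, hn⟩ := mem_iUnion.1 hy
      simpa using (hts n hn).2 (by simpa using h)
    · intro g a hga
      refine le_of_tendsto ((g.continuous.tendsto _).comp hux) (Eventually.of_forall fun n => ?_)
      have hconv : Convex ℝ {y : Y | g y ≤ a} :=
        convex_halfSpace_le (g : Y →ₗ[ℝ] ℝ).isLinear a
      refine convexHull_min (fun y hy => ?_) hconv (htu n)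
      simpa using hga _ (mem_image_of_mem _ (mem_iUnion.2 ⟨n, hy⟩))
  choose A hAK hAc hA using hstep
  -- Closing {x₀} under A in countably many steps gives a countable set E; its weak closure lies in
  -- the norm-closed span of E, hence is norm separable.
  let D : ℕ → Set (WeakSpace ℝ Y) := fun n => n.rec {x₀} fun _ s => ⋃ x ∈ s, A x
  have hDc : ∀ n, (D n).Countable := by
    intro n
    induction n with
    | zero => exact countable_singleton _
    | succ n ih => exact ih.biUnion fun x _ => hAc x
  have hDK : ∀ n, D n ⊆ K := by
    rintro (_ | n)
    · exact singleton_subset_iff.2 hx₀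
    · exact iUnion₂_subset fun x _ => hAK x
  set E : Set (WeakSpace ℝ Y) := ⋃ n, D n with hE
  have hEc : E.Countable := countable_iUnion hDc
  have hEK : E ⊆ K := iUnion_subset hDK
  have hEA : ∀ x ∈ E, A x ⊆ E := by
    intro x hx
    obtain ⟨n, hn⟩ := mem_iUnion.1 hx
    exact (subset_biUnion_of_mem (u := A) hn).trans (subset_iUnion D (n + 1))
  have hclK : closure E ⊆ K := closure_minimal hEK hK.isClosed
  have hsep : IsSeparable ((toWeakSpace ℝ Y).symm '' closure E) := by
    set P : Submodule ℝ Y := Submodule.span ℝ ((toWeakSpace ℝ Y).symm '' E) with hP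
    have hPsep : IsSeparable (closure (P : Set Y)) :=
      ((hEc.image _).isSeparable.span (R := ℝ)).closure
    refine hPsep.mono ?_
    rintro _ ⟨y, hy, rfl⟩
    have hcl := isClosed_preimage_toWeakSpace_symm (C := closure (P : Set Y))
      P.convex.closure isClosed_closure
    have hsub : E ⊆ (toWeakSpace ℝ Y).symm ⁻¹' closure (P : Set Y) := fun z hz =>
      show (toWeakSpace ℝ Y).symm z ∈ closure (P : Set Y) from
        subset_closure (Submodule.subset_span (mem_image_of_mem _ hz))
    exact closure_minimal hsub hcl hy
  obtain ⟨g, a, d, ⟨x, hx, hxa⟩, hg⟩ := exists_small_slice_of_isSeparable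
    (hK.of_isClosed_subset isClosed_closure hclK) (fun x hx => hR x (hclK hx)) hsep f
    (subset_closure (mem_iUnion.2 ⟨0, mem_singleton x₀⟩)) hc (half_pos hε)
  obtain ⟨y, hya, hyE⟩ := mem_closure_iff.1 hx _
    (isOpen_lt continuous_const (continuous_apply_toWeakSpace_symm g)) hxa
  have hy := hg y (subset_closure hyE) hya
  -- The slice lies within ε/2 of d, hence within ε of y, so it contains no point of `A y`; but then
  -- g ≤ a on `A y` forces g y ≤ a.
  refine not_le.2 hya ((hA y (hEK hyE) hy.1).2 g a fun z hz => ?_)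
  by_contra hza
  have hz' := hg z (subset_closure (hEA y hyE hz)) (not_le.1 hza)
  have h1 := (hA y (hEK hyE) hy.1).1 z hz hz'.1
  have h2 := norm_sub_le ((toWeakSpace ℝ Y).symm z - d) ((toWeakSpace ℝ Y).symm y - d)
  rw [sub_sub_sub_cancel_right] at h2
  linarith [hy.2, hz'.2]

/-- If `S` has norm one on the unit ball and maps it into a weakly compact set, then some slice
pulled back by `S` is contained in a ball of radius about `‖S + 1‖` centred on the sphere. -/
theorem exists_slice_subset_closedBall (S : Y →L[ℝ] Y) (hS : ‖S‖ = 1)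
    {K : Set (WeakSpace ℝ Y)} (hK : IsCompact K) (hSK : ∀ y : Y, ‖y‖ ≤ 1 → toWeakSpace ℝ Y (S y) ∈ K)
    (hKcl : K ⊆ closure (toWeakSpace ℝ Y '' (S '' Metric.closedBall 0 1)))
    {ε : ℝ} (hε : 0 < ε) :
    ∃ (g : StrongDual ℝ Y) (a : ℝ) (u : Y), ‖u‖ = 1 ∧ 0 ≤ a ∧ (∃ y : Y, ‖y‖ ≤ 1 ∧ a < g (S y)) ∧
      ∀ y : Y, ‖y‖ ≤ 1 → a < g (S y) →
        ‖y - u‖ ≤ ‖S + ContinuousLinearMap.id ℝ Y‖ + ε := by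
  set δ := min (ε / 3) (1 / 2) with hδ
  have hδ0 : 0 < δ := by positivity
  have hδε : 3 * δ ≤ ε := by linarith [min_le_left (ε / 3) (1 / 2)]
  have hδ1 : δ ≤ 1 / 2 := min_le_right _ _
  have hSle : ∀ y : Y, ‖y‖ ≤ 1 → ‖S y‖ ≤ 1 := fun y hy => by
    simpa [hS] using S.le_opNorm_of_le hy
  have hKle : ∀ x ∈ K, ‖(toWeakSpace ℝ Y).symm x‖ ≤ 1 := by
    intro x hx
    have hcl := isClosed_preimage_toWeakSpace_symm (Y := Y)
      (convex_closedBall 0 1) Metric.isClosed_closedBall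
    have := closure_minimal (s := toWeakSpace ℝ Y '' (S '' Metric.closedBall 0 1)) (by
      rintro _ ⟨_, ⟨y, hy, rfl⟩, rfl⟩
      simpa using hSle y (by simpa using hy)) hcl (hKcl hx)
    simpa using this
  obtain ⟨y₀, hy₀, hy₀'⟩ : ∃ y₀ : Y, ‖y₀‖ < 1 ∧ 1 - δ < ‖S y₀‖ :=
    S.exists_lt_apply_of_lt_opNorm (by linarith)
  have : Nontrivial Y := by
    refine ⟨⟨S y₀, 0, fun h => ?_⟩⟩
    rw [h, norm_zero] at hy₀'
    linarith
  obtain ⟨f, hf, hfy⟩ := exists_dual_vector' ℝ (S y₀)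
  obtain ⟨g, a, d, ⟨x, hxK, hxa⟩, hg⟩ := exists_small_slice hK hKle f (hSK y₀ hy₀.le)
    (c := 1 - δ) (by simpa [hfy] using hy₀') (half_pos hδ0)
  have hg' : ∀ y : Y, ‖y‖ ≤ 1 → a < g (S y) → 1 - δ < f (S y) ∧ ‖S y - d‖ ≤ δ / 2 :=
    fun y hy hya => by simpa using hg _ (hSK y hy) (by simpa using hya)
  obtain ⟨_, hwa, ⟨_, ⟨w, hw, rfl⟩, rfl⟩⟩ := mem_closure_iff.1 (hKcl hxK) _
    (isOpen_lt continuous_const (continuous_apply_toWeakSpace_symm g)) hxa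
  replace hwa : a < g (S w) := by simpa using hwa
  replace hw : ‖w‖ ≤ 1 := by simpa using hw
  obtain ⟨hfw, hwd⟩ := hg' w hw hwa
  have hSw1 := hSle w hw
  have hSw : 1 - δ < ‖S w‖ := hfw.trans_le (by
    simpa [hf] using (le_abs_self _).trans (f.le_opNorm (S w)))
  have hSw0 : 0 < ‖S w‖ := by linarith
  refine ⟨g, a, -(‖S w‖⁻¹ • S w), ?_, ?_, ⟨w, hw, hwa⟩, fun y hy hya => ?_⟩
  · rw [norm_neg, norm_smul, norm_inv, norm_norm, inv_mul_cancel₀ hSw0.ne']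
  -- If a < 0, the origin would lie in the slice, where f ∘ S exceeds 1 - δ > 0.
  · by_contra ha
    have := (hg' 0 (by simp) (by simpa using ha)).1
    rw [map_zero, map_zero] at this
    linarith
  · have h1 : ‖S y + y‖ ≤ ‖S + ContinuousLinearMap.id ℝ Y‖ := by
      simpa using (S + ContinuousLinearMap.id ℝ Y).le_opNorm_of_le hy
    have h2 : ‖S y - S w‖ ≤ δ := by
      have := norm_sub_le (S y - d) (S w - d)
      rw [sub_sub_sub_cancel_right] at this
      linarith [(hg' y hy hya).2]
    have h3 : ‖‖S w‖⁻¹ • S w - S w‖ ≤ δ := by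
      have : ‖S w‖⁻¹ • S w - S w = (‖S w‖⁻¹ * (1 - ‖S w‖)) • S w := by
        rw [mul_sub, inv_mul_cancel₀ hSw0.ne', mul_one, sub_smul, one_smul]
      rw [this, norm_smul, norm_mul, norm_inv, norm_norm, Real.norm_of_nonneg (by linarith),
        mul_right_comm, inv_mul_cancel₀ hSw0.ne']
      linarith
    have h4 : y - -(‖S w‖⁻¹ • S w) = (S y + y) - (S y - S w) + (‖S w‖⁻¹ • S w - S w) := by abel
    rw [h4]
    have h5 := norm_add_le ((S y + y) - (S y - S w)) (‖S w‖⁻¹ • S w - S w)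
    have h6 := norm_sub_le (S y + y) (S y - S w)
    linarith

end Dentability

/-! ### Weakly compact operators and the lower bounds of (a) -/

section WeaklyCompact

variable {X : Type*} [NormedAddCommGroup X] [NormedSpace ℝ X]

theorem bddBelow_pos_and (P : ℝ → Prop) : BddBelow {r : ℝ | 0 < r ∧ P r} :=
  ⟨0, fun _ hr => hr.1.le⟩

theorem sliceIndex_le_norm_add_id {T : X →L[ℝ] X} (hT : ‖T‖ = 1) (hTc : IsWeaklyCompact T) :
    sliceIndex X ≤ ‖T + ContinuousLinearMap.id ℝ X‖ := by
  refine le_of_forall_pos_le_add fun ε hε => ?_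
  obtain ⟨g, a, u, hu, ha, ⟨y, hy, hya⟩, hg⟩ := exists_slice_subset_closedBall T hT hTc
    (fun y hy => subset_closure (mem_image_of_mem _ (mem_image_of_mem _ (by simpa using hy))))
    subset_rfl hε
  set h : StrongDual ℝ X := g.comp T with hh
  have hah : a < ‖h‖ := hya.trans_le <| by
    have := h.le_opNorm_of_le hy
    rw [mul_one] at this
    exact (le_abs_self _).trans this
  have h0 : 0 < ‖h‖ := ha.trans_lt hah
  refine csInf_le (bddBelow_pos_and _) ⟨by positivity, u, hu, slice X (‖h‖⁻¹ • h) (1 - a / ‖h‖),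
    ⟨_, _, ?_, ?_, rfl⟩, fun x hx => ?_⟩
  · rw [norm_smul, norm_inv, norm_norm, inv_mul_cancel₀ h0.ne']
  · rw [sub_pos, div_lt_one h0]
    exact hah
  · rw [mem_closedBall_iff_norm]
    refine hg x (by simpa using hx.1) ?_
    have h1 : a / ‖h‖ < ‖h‖⁻¹ * h x := by simpa using hx.2
    rw [inv_mul_eq_div, div_lt_div_iff_of_pos_right h0] at h1
    exact h1

/-- A point outside a closed convex set for the weak topology of a pairing is separated from it by
an element of the paired space. -/
theorem exists_pairing_lt_of_notMem {E F : Type*} [AddCommGroup E] [Module ℝ E] [AddCommGroup F]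
    [Module ℝ F] (B : E →ₗ[ℝ] F →ₗ[ℝ] ℝ) {C : Set (WeakBilin B)} (hC : Convex ℝ C)
    (hC' : IsClosed C) {ψ : WeakBilin B} (hψ : ψ ∉ C) :
    ∃ (g : F) (u : ℝ), (∀ a ∈ C, B a g < u) ∧ u < B ψ g := by
  obtain ⟨f, u, hu, huψ⟩ := geometric_hahn_banach_closed_point hC hC' hψ
  obtain ⟨g, rfl⟩ := LinearMap.dualEmbedding_surjective B f
  exact ⟨g, u, hu, huψ⟩

/-- The second adjoint of a weakly compact operator takes values in the space itself. -/
theorem IsWeaklyCompact.exists_bidual_comp_eq {T : X →L[ℝ] X} (hT : IsWeaklyCompact T)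
    (φ : StrongDual ℝ (StrongDual ℝ X)) :
    ∃ y : X, ∀ h : StrongDual ℝ X, φ (h.comp T) = h y := by
  wlog hφ : ‖φ‖ ≤ 1 generalizing φ
  · have h0 : 0 < ‖φ‖ := by linarith
    obtain ⟨y, hy⟩ := this (‖φ‖⁻¹ • φ) (by
      refine (ContinuousLinearMap.opNorm_smul_le _ _).trans ?_
      rw [Real.norm_of_nonneg (by positivity), inv_mul_cancel₀ h0.ne'])
    refine ⟨‖φ‖ • y, fun h => ?_⟩
    rw [map_smul, ← hy h]
    simp [h0.ne']
  let B := topDualPairing ℝ (StrongDual ℝ X)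
  let J : WeakSpace ℝ X →ₗ[ℝ] WeakBilin B :=
    (NormedSpace.inclusionInDoubleDual ℝ X : X →ₗ[ℝ] StrongDual ℝ (StrongDual ℝ X)) ∘ₗ
      ((toWeakSpace ℝ X).symm : WeakSpace ℝ X →ₗ[ℝ] X)
  have hJ : Continuous J :=
    WeakBilin.continuous_of_continuous_eval B fun g => continuous_apply_toWeakSpace_symm g
  let A : StrongDual ℝ X →L[ℝ] StrongDual ℝ X := (ContinuousLinearMap.compL ℝ X X ℝ).flip T
  let ψ : WeakBilin B := (φ.comp A : StrongDual ℝ (StrongDual ℝ X))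
  set K := closure (toWeakSpace ℝ X '' (T '' Metric.closedBall (0 : X) 1)) with hK
  have hKconv : Convex ℝ K :=
    (((convex_closedBall 0 1).linear_image (T : X →ₗ[ℝ] X)).linear_image
      (toWeakSpace ℝ X : X →ₗ[ℝ] WeakSpace ℝ X)).closure
  have hmemK : ∀ x : X, ‖x‖ ≤ 1 → toWeakSpace ℝ X (T x) ∈ K := fun x hx =>
    subset_closure (mem_image_of_mem _ (mem_image_of_mem _ (by simpa using hx)))
  have : T2Space (WeakBilin B) := (WeakBilin.isEmbedding (B := B)
    ContinuousLinearMap.coe_injective).t2Space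
  -- ψ is T**φ. A functional g separating it from the weak* compact convex set J(K) would satisfy ‖g
  -- ∘ T‖ ≤ u < φ(g ∘ T), against ‖φ‖ ≤ 1.
  have hψ : ψ ∈ J '' K := by
    by_contra hψ
    obtain ⟨g, u, hu, huψ⟩ := exists_pairing_lt_of_notMem B (hKconv.linear_image J)
      ((hT : IsCompact K).image hJ).isClosed hψ
    have hgu : ∀ x : X, ‖x‖ ≤ 1 → g (T x) < u := fun x hx =>
      hu _ (mem_image_of_mem J (hmemK x hx))
    have hnorm : ‖g.comp T‖ ≤ u := by
      refine ContinuousLinearMap.opNorm_le_of_unit_norm ?_ fun x hx => ?_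
      · simpa using (hgu 0 (by simp)).le
      · refine abs_le.2 ⟨?_, (hgu x hx.le).le⟩
        have := hgu (-x) (by rw [norm_neg, hx])
        rw [map_neg, map_neg] at this
        exact neg_le.1 this.le
    have h1 : u < φ (g.comp T) := huψ
    have h2 : φ (g.comp T) ≤ 1 * u := (le_abs_self _).trans (φ.le_of_opNorm_le_of_le hφ hnorm)
    linarith
  obtain ⟨k, -, hk⟩ := hψ
  exact ⟨(toWeakSpace ℝ X).symm k, fun h => (congrArg
    (fun θ : StrongDual ℝ (StrongDual ℝ X) => θ h) hk).symm⟩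

/-- The adjoint A is weak*-to-weak continuous, because each φ ∘ A is evaluation at a point of X.
Hence A maps the weak* compact dual ball onto a weakly compact set, and the slices it pulls back are
weak* slices. -/
theorem weakStarSliceIndex_le_norm_add_id {T : X →L[ℝ] X} (hT : ‖T‖ = 1)
    (hTc : IsWeaklyCompact T) :
    weakStarSliceIndex X ≤ ‖T + ContinuousLinearMap.id ℝ X‖ := by
  let A : StrongDual ℝ X →L[ℝ] StrongDual ℝ X := (ContinuousLinearMap.compL ℝ X X ℝ).flip T
  have hAapp : ∀ h, A h = h.comp T := fun h => rfl
  have hA : ‖A‖ = 1 := by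
    refine le_antisymm (A.opNorm_le_bound zero_le_one fun h => ?_) ?_
    · rw [hAapp, one_mul]
      simpa [hT] using h.opNorm_comp_le T
    · rw [← hT]
      refine T.opNorm_le_bound (norm_nonneg A) fun x => ?_
      obtain ⟨h, hh, hx⟩ := exists_dual_vector'' ℝ (T x)
      calc ‖T x‖ = A h x := by simpa [hAapp] using hx.symm
        _ ≤ ‖A h‖ * ‖x‖ := (le_abs_self _).trans ((A h).le_opNorm x)
        _ ≤ ‖A‖ * ‖x‖ := mul_le_mul_of_nonneg_right
          (by simpa using A.le_opNorm_of_le hh) (norm_nonneg _)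
  have hAid : ‖A + ContinuousLinearMap.id ℝ (StrongDual ℝ X)‖ ≤
      ‖T + ContinuousLinearMap.id ℝ X‖ := by
    refine ContinuousLinearMap.opNorm_le_bound _ (norm_nonneg _) fun h => ?_
    have : (A + ContinuousLinearMap.id ℝ (StrongDual ℝ X)) h =
        h.comp (T + ContinuousLinearMap.id ℝ X) := by
      ext x; simp [hAapp]
    rw [this, mul_comm]
    exact h.opNorm_comp_le _
  have hcont : Continuous fun w : WeakDual ℝ X =>
      toWeakSpace ℝ (StrongDual ℝ X) (A (WeakDual.toStrongDual w)) := by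
    refine WeakBilin.continuous_of_continuous_eval _ fun φ => ?_
    obtain ⟨y, hy⟩ := hTc.exists_bidual_comp_eq φ
    have : (fun w : WeakDual ℝ X => φ (A (WeakDual.toStrongDual w))) = fun w => w y := by
      ext w; exact hy _
    exact this ▸ WeakDual.eval_continuous y
  have hK := (WeakDual.isCompact_closedBall (𝕜 := ℝ) (0 : StrongDual ℝ X) 1).image hcont
  refine le_of_forall_pos_le_add fun ε hε => ?_
  obtain ⟨φ, a, u, hu, ha, ⟨h, hh, hha⟩, hφ⟩ := exists_slice_subset_closedBall A hA hK
    (fun h hh => ⟨StrongDual.toWeakDual h, by simpa using hh, rfl⟩)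
    (by
      rintro _ ⟨w, hw, rfl⟩
      exact subset_closure (mem_image_of_mem _ (mem_image_of_mem _ hw))) hε
  obtain ⟨y, hy⟩ := hTc.exists_bidual_comp_eq φ
  simp only [hAapp, hy] at hha hφ
  have hay : a < ‖y‖ := hha.trans_le <| by
    have := h.le_of_opNorm_le hh y
    rw [one_mul] at this
    exact (le_abs_self _).trans this
  have h0 : 0 < ‖y‖ := ha.trans_lt hay
  refine csInf_le (bddBelow_pos_and _) ⟨by positivity, u, hu,
    weakStarSlice X (‖y‖⁻¹ • y) (1 - a / ‖y‖), ⟨_, _, ?_, ?_, rfl⟩, fun k hk => ?_⟩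
  · rw [norm_smul, norm_inv, norm_norm, inv_mul_cancel₀ h0.ne']
  · rw [sub_pos, div_lt_one h0]
    exact hay
  · rw [mem_closedBall_iff_norm]
    refine (hφ k (by simpa using hk.1) ?_).trans (by linarith)
    have h1 : a / ‖y‖ < ‖y‖⁻¹ * k y := by simpa using hk.2
    rw [inv_mul_eq_div, div_lt_div_iff_of_pos_right h0] at h1
    exact h1

end WeaklyCompact

/-! ### The renorming of c₀ -/

noncomputable section Renorming

section Gauge

variable {E : Type*} [NormedAddCommGroup E] [NormedSpace ℝ E] {b : Set E}

theorem gauge_add_le_of_mem_nhds (hb : Convex ℝ b) (h : b ∈ 𝓝 0) (x y : E) :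
    gauge b (x + y) ≤ gauge b x + gauge b y :=
  gauge_add_le hb (absorbent_nhds_zero h) x y

theorem gauge_smul_of_neg_mem (hb : Convex ℝ b) (hneg : ∀ y ∈ b, -y ∈ b) (c : ℝ) (x : E) :
    gauge b (c • x) = ‖c‖ * gauge b x :=
  gauge_smul ((balanced_iff_neg_mem hb).2 hneg) c x

theorem exists_eq_smul_of_gauge_lt (h : b ∈ 𝓝 0) {x : E} {a : ℝ} (hx : gauge b x < a) :
    ∃ r z, 0 < r ∧ r < a ∧ z ∈ b ∧ x = r • z := by
  obtain ⟨r, hr, hra, z, hz, hzx⟩ := exists_lt_of_gauge_lt (absorbent_nhds_zero h) hx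
  exact ⟨r, z, hr, hra, hz, hzx.symm⟩

theorem norm_le_gauge_of_subset_closedBall (h : b ∈ 𝓝 0) (hb : b ⊆ Metric.closedBall 0 1) (x : E) :
    ‖x‖ ≤ gauge b x := by
  simpa using le_gauge_of_subset_closedBall (absorbent_nhds_zero h) zero_le_one hb (x := x)

end Gauge

theorem norm_zeroAtInfty_le {y : C₀(ℕ, ℝ)} {c : ℝ} (hc : 0 ≤ c) :
    ‖y‖ ≤ c ↔ ∀ n, |y n| ≤ c := by
  rw [← ZeroAtInftyContinuousMap.norm_toBCF_eq_norm, BoundedContinuousFunction.norm_le hc]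
  rfl

theorem abs_apply_le_norm (y : C₀(ℕ, ℝ)) (n : ℕ) : |y n| ≤ ‖y‖ :=
  (norm_zeroAtInfty_le (norm_nonneg y)).1 le_rfl n

theorem tendsto_zeroAtInfty_atTop (y : C₀(ℕ, ℝ)) : Tendsto y atTop (𝓝 0) := by
  have := y.zero_at_infty'
  rwa [cocompact_eq_cofinite, Nat.cofinite_eq_atTop] at this

/-- The unit vectors of `c₀`. -/
def unitVec (n : ℕ) : C₀(ℕ, ℝ) where
  toFun := Pi.single n 1
  continuous_toFun := continuous_of_discreteTopology
  zero_at_infty' := by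
    rw [cocompact_eq_cofinite, Nat.cofinite_eq_atTop]
    refine tendsto_const_nhds.congr' ?_
    filter_upwards [eventually_gt_atTop n] with m hm
    exact (Pi.single_eq_of_ne (M := fun _ => ℝ) hm.ne' 1).symm

theorem unitVec_apply (n m : ℕ) : unitVec n m = if m = n then 1 else 0 :=
  Pi.single_apply n 1 m

/-- The coordinate functionals of `c₀`. -/
def evalAt (n : ℕ) : StrongDual ℝ C₀(ℕ, ℝ) :=
  LinearMap.mkContinuous
    { toFun := fun y => y n
      map_add' := fun _ _ => rfl
      map_smul' := fun _ _ => rfl } 1 fun y => by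
        rw [one_mul]; exact abs_apply_le_norm y n

@[simp] theorem evalAt_apply (n : ℕ) (y : C₀(ℕ, ℝ)) : evalAt n y = y n := rfl

/-- Testing f on finite sign vectors shows that its coefficients are absolutely summable. -/
theorem tendsto_apply_unitVec (f : StrongDual ℝ C₀(ℕ, ℝ)) :
    Tendsto (fun n => f (unitVec n)) atTop (𝓝 0) := by
  have hsum : Summable fun n => |f (unitVec n)| := by
    refine summable_of_sum_le (c := ‖f‖) (fun _ => abs_nonneg _) fun s => ?_
    set v : C₀(ℕ, ℝ) := ∑ n ∈ s, (SignType.sign (f (unitVec n)) : ℝ) • unitVec n with hv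
    have hv1 : ‖v‖ ≤ 1 := by
      refine (norm_zeroAtInfty_le zero_le_one).2 fun m => ?_
      have : v m = if m ∈ s then (SignType.sign (f (unitVec m)) : ℝ) else 0 := by
        rw [← evalAt_apply, hv, map_sum]
        simp [unitVec_apply]
      rw [this]
      split_ifs
      · rcases SignType.sign (f (unitVec m)) with _ | _ | _ <;> simp
      · simp
    calc ∑ n ∈ s, |f (unitVec n)| = f v := by
          rw [hv, map_sum]
          exact Finset.sum_congr rfl fun n _ => by
            rw [map_smul, smul_eq_mul, sign_mul_self]
      _ ≤ ‖f‖ * ‖v‖ := (le_abs_self _).trans (f.le_opNorm v)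
      _ ≤ ‖f‖ := mul_le_of_le_one_right (norm_nonneg f) hv1
  exact (tendsto_zero_iff_abs_tendsto_zero _).2 hsum.tendsto_atTop_zero

/-- The vectors generating the unit ball of the renorming: those of sup norm at most `1` whose
positive coordinates of one parity vanish, and those of sup norm at most `4 / 5`. -/
def generators : Set C₀(ℕ, ℝ) :=
  {y | ‖y‖ ≤ 1 ∧ ∀ n, n ≠ 0 → Even n → y n = 0} ∪ {y | ‖y‖ ≤ 1 ∧ ∀ n, Odd n → y n = 0} ∪
    Metric.closedBall 0 (4 / 5)

/-- The convex body whose gauge is the norm of the renorming. -/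
def body : Set C₀(ℕ, ℝ) := convexHull ℝ generators

theorem generators_subset_body : generators ⊆ body := subset_convexHull ℝ _

theorem convex_body : Convex ℝ body := convex_convexHull ℝ _

theorem norm_le_one_of_mem_generators {y : C₀(ℕ, ℝ)} (hy : y ∈ generators) : ‖y‖ ≤ 1 := by
  rcases hy with (hy | hy) | hy
  · exact hy.1
  · exact hy.1
  · rw [mem_closedBall_zero_iff] at hy
    linarith

theorem body_subset_closedBall : body ⊆ Metric.closedBall 0 1 :=
  convexHull_min (fun _ hy => by simpa using norm_le_one_of_mem_generators hy)
    (convex_closedBall 0 1)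

theorem ball_subset_body : Metric.ball (0 : C₀(ℕ, ℝ)) (4 / 5) ⊆ body := fun _ hy =>
  generators_subset_body (Or.inr (Metric.ball_subset_closedBall hy))

theorem body_mem_nhds : body ∈ 𝓝 (0 : C₀(ℕ, ℝ)) :=
  mem_of_superset (Metric.ball_mem_nhds 0 (by norm_num)) ball_subset_body

theorem neg_mem_generators {y : C₀(ℕ, ℝ)} (hy : y ∈ generators) : -y ∈ generators := by
  rcases hy with (⟨h, h'⟩ | ⟨h, h'⟩) | h
  · exact Or.inl (Or.inl ⟨by rwa [norm_neg], fun n hn hn' => by simp [h' n hn hn']⟩)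
  · exact Or.inl (Or.inr ⟨by rwa [norm_neg], fun n hn => by simp [h' n hn]⟩)
  · exact Or.inr (by simpa using h)

theorem neg_mem_body {y : C₀(ℕ, ℝ)} (hy : y ∈ body) : -y ∈ body := by
  have : body ⊆ -body := convexHull_min
    (fun z hz => generators_subset_body (neg_mem_generators hz)) convex_body.neg
  exact this hy

theorem norm_le_gauge_body (y : C₀(ℕ, ℝ)) : ‖y‖ ≤ gauge body y :=
  norm_le_gauge_of_subset_closedBall body_mem_nhds body_subset_closedBall y

theorem gauge_body_le (y : C₀(ℕ, ℝ)) : gauge body y ≤ 5 / 4 * ‖y‖ := by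
  have := mul_gauge_le_norm ball_subset_body (x := y)
  linarith

/-- A renorming of `c₀`: the norm is the gauge of `body`. -/
def ParityRenorming : Type := C₀(ℕ, ℝ)

/-! ### The renormed space and its indices -/

namespace ParityRenorming

instance : AddCommGroup ParityRenorming := inferInstanceAs (AddCommGroup C₀(ℕ, ℝ))

instance : Module ℝ ParityRenorming := inferInstanceAs (Module ℝ C₀(ℕ, ℝ))

/-- The identity map onto `c₀`. -/
def toC0 : ParityRenorming ≃ₗ[ℝ] C₀(ℕ, ℝ) := LinearEquiv.refl ℝ _

instance : Norm ParityRenorming := ⟨fun y => gauge body (toC0 y)⟩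

theorem norm_def (y : ParityRenorming) : ‖y‖ = gauge body (toC0 y) := rfl

theorem core : NormedSpace.Core ℝ ParityRenorming where
  norm_nonneg _ := gauge_nonneg _
  norm_smul c y := by
    simp only [norm_def, map_smul]
    exact gauge_smul_of_neg_mem convex_body (fun _ => neg_mem_body) c _
  norm_triangle x y := by
    simp only [norm_def, map_add]
    exact gauge_add_le_of_mem_nhds convex_body body_mem_nhds _ _
  norm_eq_zero_iff y := by
    refine ⟨fun h => ?_, fun h => ?_⟩
    · have := norm_le_gauge_body (toC0 y)
      rw [← norm_def, h] at this
      simpa using norm_le_zero_iff.1 this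
    · simp [norm_def, h]

instance : NormedAddCommGroup ParityRenorming := NormedAddCommGroup.ofCore core

instance : NormedSpace ℝ ParityRenorming := NormedSpace.ofCore core

theorem norm_toC0_le (y : ParityRenorming) : ‖toC0 y‖ ≤ ‖y‖ := norm_le_gauge_body _

theorem norm_le_norm_toC0 (y : ParityRenorming) : ‖y‖ ≤ 5 / 4 * ‖toC0 y‖ := gauge_body_le _

/-- The identity map onto `c₀` as a linear homeomorphism. -/
def equivC0 : ParityRenorming ≃L[ℝ] C₀(ℕ, ℝ) :=
  toC0.toContinuousLinearEquivOfBounds 1 (5 / 4) (fun y => by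
    rw [one_mul]; exact norm_toC0_le y) fun y => by
    simpa using norm_le_norm_toC0 (toC0.symm y)

instance : CompleteSpace ParityRenorming :=
  (completeSpace_congr (e := equivC0.toEquiv) equivC0.isUniformEmbedding).2 inferInstance

/-- The coordinate functionals. -/
def coord (n : ℕ) : StrongDual ℝ ParityRenorming :=
  (evalAt n).comp (equivC0 : ParityRenorming →L[ℝ] C₀(ℕ, ℝ))

theorem abs_coord_le (n : ℕ) (y : ParityRenorming) : |coord n y| ≤ ‖y‖ :=
  (abs_apply_le_norm _ n).trans (norm_toC0_le y)

theorem norm_le_of_abs_coord_le {y : ParityRenorming} {c : ℝ} (hc : 0 ≤ c)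
    (h : ∀ n, |coord n y| ≤ c) : ‖y‖ ≤ 5 / 4 * c := by
  have : ‖toC0 y‖ ≤ c := (norm_zeroAtInfty_le hc).2 h
  linarith [norm_le_norm_toC0 y]

/-- The unit vectors. -/
def vec (n : ℕ) : ParityRenorming := toC0.symm (unitVec n)

theorem coord_vec (n m : ℕ) : coord m (vec n) = if m = n then 1 else 0 :=
  unitVec_apply n m

/-- The generators seen in the renorming. -/
def gen : Set ParityRenorming := toC0 ⁻¹' generators

theorem norm_le_one_of_mem_gen {y : ParityRenorming} (hy : y ∈ gen) : ‖y‖ ≤ 1 :=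
  gauge_le_one_of_mem (generators_subset_body hy)

theorem mem_gen_iff {y : ParityRenorming} : y ∈ gen ↔
    ((∀ n, |coord n y| ≤ 1) ∧ ∀ n, n ≠ 0 → Even n → coord n y = 0) ∨
    ((∀ n, |coord n y| ≤ 1) ∧ ∀ n, Odd n → coord n y = 0) ∨ ∀ n, |coord n y| ≤ 4 / 5 := by
  simp only [gen, generators, mem_preimage, mem_union, mem_ofPred_eq, mem_closedBall_zero_iff,
    norm_zeroAtInfty_le (zero_le_one' ℝ), norm_zeroAtInfty_le (show (0 : ℝ) ≤ 4 / 5 by norm_num),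
    or_assoc]
  rfl

/-- A linear bound on the generators passes to their convex hull and then scales, so dual norms can
be computed on generators. -/
theorem apply_le_mul_norm (f : StrongDual ℝ ParityRenorming) {b : ℝ} (hb : 0 ≤ b)
    (hf : ∀ y ∈ gen, f y ≤ b) (y : ParityRenorming) : f y ≤ b * ‖y‖ := by
  have hbody : ∀ z : C₀(ℕ, ℝ), z ∈ body → f (toC0.symm z) ≤ b := by
    intro z hz
    have hconv : Convex ℝ {z : C₀(ℕ, ℝ) | f (toC0.symm z) ≤ b} :=
      convex_halfSpace_le
        ((f : ParityRenorming →ₗ[ℝ] ℝ) ∘ₗ (toC0.symm : C₀(ℕ, ℝ) →ₗ[ℝ] ParityRenorming)).isLinear b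
    exact convexHull_min (fun z hz => hf (toC0.symm z) (by simpa [gen] using hz)) hconv hz
  refine le_of_forall_pos_le_add fun ε hε => ?_
  -- The gauge is only an infimum, hence the slack; b + 1 in place of b allows b = 0.
  obtain ⟨r, z, hr, hr', hz, hzy⟩ := exists_eq_smul_of_gauge_lt body_mem_nhds
    (show gauge body (toC0 y) < ‖y‖ + ε / (b + 1) by
      rw [← norm_def]; exact lt_add_of_pos_right _ (by positivity))
  have hy : y = r • toC0.symm z := by
    apply toC0.injective
    rw [map_smul, LinearEquiv.apply_symm_apply]
    exact hzy
  have h1 : f y = r * f (toC0.symm z) := by rw [hy, map_smul, smul_eq_mul]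
  have h2 : b * (ε / (b + 1)) ≤ ε := by
    rw [mul_div_assoc', div_le_iff₀ (by positivity)]
    nlinarith
  calc f y = r * f (toC0.symm z) := h1
    _ ≤ r * b := mul_le_mul_of_nonneg_left (hbody z hz) hr.le
    _ ≤ (‖y‖ + ε / (b + 1)) * b := mul_le_mul_of_nonneg_right hr'.le hb
    _ = b * ‖y‖ + b * (ε / (b + 1)) := by ring
    _ ≤ _ := by linarith

theorem apply_le_of_norm_le_one (f : StrongDual ℝ ParityRenorming) {b : ℝ} (hb : 0 ≤ b)
    (hf : ∀ y ∈ gen, f y ≤ b) {y : ParityRenorming} (hy : ‖y‖ ≤ 1) : f y ≤ b :=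
  (apply_le_mul_norm f hb hf y).trans (mul_le_of_le_one_right hb hy)

theorem norm_le_of_apply_gen_le (f : StrongDual ℝ ParityRenorming) {b : ℝ} (hb : 0 ≤ b)
    (hf : ∀ y ∈ gen, f y ≤ b) : ‖f‖ ≤ b := by
  refine f.opNorm_le_bound hb fun y => abs_le.2 ⟨?_, apply_le_mul_norm f hb hf y⟩
  have := apply_le_mul_norm f hb hf (-y)
  rw [map_neg, norm_neg] at this
  linarith

/-- A norm one vector with small weak neighbourhoods in the unit ball. -/
def thinPoint : ParityRenorming := vec 0 + (2⁻¹ : ℝ) • vec 1 + (2⁻¹ : ℝ) • vec 2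

/-- A norm one functional with small weak-star neighbourhoods in the dual unit ball. -/
def thinFunctional : StrongDual ℝ ParityRenorming :=
  (3 / 4 : ℝ) • coord 0 + (1 / 4 : ℝ) • coord 1 + (1 / 4 : ℝ) • coord 2

theorem thinFunctional_apply (y : ParityRenorming) :
    thinFunctional y = 3 / 4 * coord 0 y + 1 / 4 * coord 1 y + 1 / 4 * coord 2 y := rfl

theorem thinFunctional_thinPoint : thinFunctional thinPoint = 1 := by
  simp only [thinFunctional_apply, thinPoint, map_add, map_smul, coord_vec]
  norm_num

/-- The point is the midpoint of e₀ + e₁ and e₀ + e₂, generators of opposite parity. -/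
theorem norm_thinPoint_le : ‖thinPoint‖ ≤ 1 := by
  have h : ∀ i, i = 1 ∨ i = 2 → ‖vec 0 + vec i‖ ≤ 1 := by
    intro i hi
    refine norm_le_one_of_mem_gen (mem_gen_iff.2 ?_)
    have hc : ∀ n, coord n (vec 0 + vec i) = (if n = 0 then 1 else 0) + if n = i then 1 else 0 := by
      intro n
      rw [map_add, coord_vec, coord_vec]
    have habs : ∀ n, |coord n (vec 0 + vec i)| ≤ 1 := by
      intro n
      rw [hc]
      rcases hi with rfl | rfl <;> split_ifs <;> first | omega | norm_num
    rcases hi with rfl | rfl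
    · refine Or.inl ⟨habs, fun n hn hn' => ?_⟩
      rw [hc, if_neg hn, if_neg, add_zero]
      rintro rfl
      exact absurd hn' (by decide)
    · refine Or.inr (Or.inl ⟨habs, fun n hn => ?_⟩)
      rw [hc, if_neg, if_neg, add_zero]
      · rintro rfl
        exact absurd hn (by decide)
      · rintro rfl
        exact absurd hn (by decide)
  have heq : thinPoint = (2⁻¹ : ℝ) • (vec 0 + vec 1) + (2⁻¹ : ℝ) • (vec 0 + vec 2) := by
    rw [thinPoint]; module
  rw [heq]
  refine (norm_add_le _ _).trans ?_
  rw [norm_smul, norm_smul, Real.norm_of_nonneg (by norm_num)]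
  linarith [h 1 (Or.inl rfl), h 2 (Or.inr rfl)]

/-- Each parity class kills coordinate 1 or 2, leaving 3/4 + 1/4 = 1; on the small cube the bound is
5/4 · 4/5 = 1. -/
theorem norm_thinFunctional_le : ‖thinFunctional‖ ≤ 1 := by
  refine norm_le_of_apply_gen_le _ zero_le_one fun y hy => ?_
  rw [thinFunctional_apply]
  rcases mem_gen_iff.1 hy with ⟨h, h'⟩ | ⟨h, h'⟩ | h
  · have := h' 2 two_ne_zero even_two
    linarith [le_of_abs_le (h 0), le_of_abs_le (h 1)]
  · have := h' 1 odd_one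
    linarith [le_of_abs_le (h 0), le_of_abs_le (h 2)]
  · linarith [le_of_abs_le (h 0), le_of_abs_le (h 1), le_of_abs_le (h 2)]

theorem norm_thinPoint : ‖thinPoint‖ = 1 := by
  refine le_antisymm norm_thinPoint_le ?_
  have := (le_abs_self _).trans (thinFunctional.le_of_opNorm_le norm_thinFunctional_le thinPoint)
  rwa [thinFunctional_thinPoint, one_mul] at this

theorem norm_thinFunctional : ‖thinFunctional‖ = 1 := by
  refine le_antisymm norm_thinFunctional_le ?_
  have := (le_abs_self _).trans (thinFunctional.le_opNorm_of_le norm_thinPoint_le)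
  rwa [thinFunctional_thinPoint, mul_one] at this

theorem exists_mem_gen_lt {f : StrongDual ℝ ParityRenorming} (hf : ‖f‖ = 1) {α : ℝ} (hα : 0 < α) :
    ∃ y ∈ gen, 1 - α < f y := by
  by_contra! h
  have := norm_le_of_apply_gen_le f (le_max_right (1 - α) 0)
    fun y hy => (h y hy).trans (le_max_left _ _)
  rw [hf] at this
  exact absurd this (not_le.2 (max_lt (by linarith) one_pos))

/-- Each generator can be given a coordinate of modulus at least `4 / 5` arbitrarily far out. -/
theorem exists_frequently_mem_gen {y : ParityRenorming} (hy : y ∈ gen) :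
    ∃ t : ℝ, 4 / 5 ≤ t ∧ ∃ᶠ n in atTop, y + (t - coord n y) • vec n ∈ gen := by
  have hc : ∀ (t : ℝ) (n m : ℕ), coord m (y + (t - coord n y) • vec n) =
      if m = n then t else coord m y := by
    intro t n m
    rw [map_add, map_smul, coord_vec]
    split_ifs with h
    · subst h; simp
    · simp
  have habs : ∀ {t : ℝ} (n : ℕ), 0 ≤ t → (∀ m, |coord m y| ≤ t) →
      ∀ m, |coord m (y + (t - coord n y) • vec n)| ≤ t := by
    intro t n ht h m
    rw [hc]
    split_ifs
    · rw [abs_of_nonneg ht]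
    · exact h m
  rcases mem_gen_iff.1 hy with ⟨h, h'⟩ | ⟨h, h'⟩ | h
  · refine ⟨1, by norm_num, frequently_atTop.2 fun N => ⟨2 * N + 1, by omega, ?_⟩⟩
    refine mem_gen_iff.2 (Or.inl ⟨habs _ zero_le_one h, fun m hm hm' => ?_⟩)
    rw [hc, if_neg, h' m hm hm']
    rintro rfl
    exact absurd hm' (by simp [parity_simps])
  · refine ⟨1, by norm_num, frequently_atTop.2 fun N => ⟨2 * N, by omega, ?_⟩⟩
    refine mem_gen_iff.2 (Or.inr (Or.inl ⟨habs _ zero_le_one h, fun m hm => ?_⟩))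
    rw [hc, if_neg, h' m hm]
    rintro rfl
    exact absurd hm (by simp)
  · exact ⟨4 / 5, le_rfl, frequently_atTop.2 fun N => ⟨N, le_rfl,
      mem_gen_iff.2 (Or.inr (Or.inr (habs _ (by norm_num) h)))⟩⟩

/-- Unit vectors are weakly null, so changing a far coordinate of a generator keeps it in the slice,
while the centre x has far coordinates near 0. -/
theorem le_sliceIndex : 4 / 5 ≤ sliceIndex ParityRenorming := by
  refine le_csInf ⟨2, two_pos, thinPoint, norm_thinPoint, slice _ thinFunctional 1,
    ⟨_, _, norm_thinFunctional, one_pos, rfl⟩, fun y hy => ?_⟩ ?_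
  · rw [mem_closedBall_iff_norm]
    have h1 : ‖y‖ ≤ 1 := by simpa using hy.1
    linarith [norm_sub_le y thinPoint, norm_thinPoint]
  · rintro r ⟨-, x, -, _, ⟨f, α, hf, hα, rfl⟩, hS⟩
    obtain ⟨y, hy, hfy⟩ := exists_mem_gen_lt hf hα
    obtain ⟨t, ht, hfreq⟩ := exists_frequently_mem_gen hy
    refine le_of_forall_pos_le_add fun ε hε => ?_
    have hvec : Tendsto (fun n => f (vec n)) atTop (𝓝 0) := tendsto_apply_unitVec
      (f.comp (equivC0.symm : C₀(ℕ, ℝ) →L[ℝ] ParityRenorming))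
    have hlim : Tendsto (fun n => f (y + (t - coord n y) • vec n)) atTop (𝓝 (f y)) := by
      have hcy : Tendsto (fun n => coord n y) atTop (𝓝 0) := tendsto_zeroAtInfty_atTop (toC0 y)
      have := tendsto_const_nhds (x := f y) |>.add ((tendsto_const_nhds (x := t) |>.sub hcy).mul hvec)
      simpa using this
    have hxε : ∀ᶠ n in atTop, coord n x < ε :=
      (tendsto_zeroAtInfty_atTop (toC0 x)).eventually_lt_const hε
    obtain ⟨n, hn, hn', hnx⟩ :=
      (hfreq.and_eventually ((hlim.eventually_const_lt hfy).and hxε)).exists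
    have hmem := hS (show y + (t - coord n y) • vec n ∈ slice _ f α from
      ⟨by simpa using norm_le_one_of_mem_gen hn, hn'⟩)
    rw [mem_closedBall_iff_norm] at hmem
    have h1 := (le_abs_self _).trans ((abs_coord_le n _).trans hmem)
    have h2 : coord n (y + (t - coord n y) • vec n - x) = t - coord n x := by
      rw [map_sub, map_add, map_smul, coord_vec, if_pos rfl]
      simp
    rw [h2] at h1
    linarith

/-- The coordinates of a vector of the unit ball are constrained by three of them. -/
theorem abs_coord_add_le {y : ParityRenorming} (hy : ‖y‖ ≤ 1) (n : ℕ) (hn : n ≠ 0) :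
    ∃ i, (i = 1 ∨ i = 2) ∧ (n = 1 → i = 2) ∧ (n = 2 → i = 1) ∧
      |coord n y| + coord i y + 3 * coord 0 y ≤ 4 := by
  -- i is the index in {1, 2} of parity opposite to n, so a parity generator vanishes at n or at i.
  -- The bound 4 is then 1 + 3, and on the small cube 5 · 4/5.
  obtain ⟨i, hi, h1, h2, hodd, heven⟩ : ∃ i, (i = 1 ∨ i = 2) ∧ (n = 1 → i = 2) ∧ (n = 2 → i = 1) ∧
      (Odd n → i = 2) ∧ (Even n → i = 1) := by
    rcases Nat.even_or_odd n with h | h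
    · exact ⟨1, Or.inl rfl, by rintro rfl; exact absurd h (by decide), fun _ => rfl,
        fun h' => absurd h (Nat.not_even_iff_odd.2 h'), fun _ => rfl⟩
    · exact ⟨2, Or.inr rfl, fun _ => rfl, by rintro rfl; exact absurd h (by decide),
        fun _ => rfl, fun h' => absurd h' (Nat.not_even_iff_odd.2 h)⟩
  refine ⟨i, hi, h1, h2, ?_⟩
  have key : ∀ σ : ℝ, |σ| = 1 → σ * coord n y + coord i y + 3 * coord 0 y ≤ 4 := by
    intro σ hσ
    refine apply_le_of_norm_le_one (σ • coord n + coord i + (3 : ℝ) • coord 0) (by norm_num)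
      (fun z hz => ?_) hy
    change σ * coord n z + coord i z + 3 * coord 0 z ≤ 4
    have hσz : σ * coord n z ≤ |coord n z| := (le_abs_self _).trans (by rw [abs_mul, hσ, one_mul])
    rcases mem_gen_iff.1 hz with ⟨h, h'⟩ | ⟨h, h'⟩ | h
    · rcases Nat.even_or_odd n with hn' | hn'
      · rw [h' n hn hn', abs_zero] at hσz
        rw [h' n hn hn']
        linarith [le_of_abs_le (h i), le_of_abs_le (h 0)]
      · have : coord i z = 0 := by rw [hodd hn']; exact h' 2 two_ne_zero even_two
        linarith [h n, le_of_abs_le (h 0)]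
    · rcases Nat.even_or_odd n with hn' | hn'
      · have : coord i z = 0 := by rw [heven hn']; exact h' 1 odd_one
        linarith [h n, le_of_abs_le (h 0)]
      · rw [h' n hn']
        linarith [le_of_abs_le (h i), le_of_abs_le (h 0)]
    · linarith [h n, le_of_abs_le (h i), le_of_abs_le (h 0)]
  rcases abs_choice (coord n y) with h | h <;> rw [h]
  · simpa using key 1 (by simp)
  · simpa using key (-1) (by simp)

theorem index_le : index ParityRenorming ≤ 7 / 10 := by
  have hopen : ∀ (n : ℕ) (c : ℝ), IsOpen {z : WeakSpace ℝ ParityRenorming |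
      c < coord n ((toWeakSpace ℝ ParityRenorming).symm z)} := fun n c =>
    isOpen_lt continuous_const (continuous_apply_toWeakSpace_symm _)
  refine csInf_le (bddBelow_pos_and _) ⟨by norm_num, thinPoint, norm_thinPoint, _,
    ⟨_, (hopen 0 (99 / 100)).inter ((hopen 1 (49 / 100)).inter (hopen 2 (49 / 100))), rfl⟩,
    ⟨thinPoint, by simpa using norm_thinPoint_le, ?_⟩, ?_⟩
  · simp only [mem_preimage, mem_inter_iff, mem_ofPred_eq, LinearEquiv.symm_apply_apply, thinPoint,
      map_add, map_smul, coord_vec]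
    norm_num
  · rintro y ⟨hy, hy'⟩
    simp only [mem_preimage, mem_inter_iff, mem_ofPred_eq, LinearEquiv.symm_apply_apply] at hy'
    obtain ⟨h0, h1, h2⟩ := hy'
    replace hy : ‖y‖ ≤ 1 := by simpa using hy
    have hle := abs_coord_add_le hy
    rw [mem_closedBall_iff_norm]
    -- For n ≠ 0, `abs_coord_add_le` gives |y n| ≤ 4 - 0.49 - 3 · 0.99 = 0.54, and 5/4 · 0.54 <
    -- 7/10.
    refine (norm_le_of_abs_coord_le (c := 54 / 100) (by norm_num) fun n => ?_).trans (by norm_num)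
    have hx : coord n thinPoint = (if n = 0 then 1 else 0) + 2⁻¹ * (if n = 1 then 1 else 0) +
        2⁻¹ * (if n = 2 then 1 else 0) := by
      simp only [thinPoint, map_add, map_smul, coord_vec, smul_eq_mul]
    rw [map_sub, hx]
    rcases Nat.eq_zero_or_pos n with rfl | hn
    · have := (abs_coord_le 0 y).trans hy
      rw [abs_le] at this ⊢
      norm_num
      constructor <;> linarith
    · obtain ⟨i, hi, hi1, hi2, hin⟩ := hle n hn.ne'
      have hi' : 49 / 100 < coord i y := by rcases hi with rfl | rfl <;> assumption
      have hb : |coord n y| ≤ 54 / 100 := by linarith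
      rw [abs_le] at hb
      rw [if_neg hn.ne']
      by_cases hn1 : n = 1
      · subst hn1
        norm_num
        rw [abs_le]
        constructor <;> linarith
      by_cases hn2 : n = 2
      · subst hn2
        norm_num
        rw [abs_le]
        constructor <;> linarith
      · rw [if_neg hn1, if_neg hn2, abs_le]
        constructor <;> linarith

/-- The cube has norm at most 5/4, so dual unit vectors have ℓ₁ norm at most 5/4. `thinFunctional`
attains this on three coordinates, so any functional close to it there has almost no mass elsewhere.
-/
theorem weakStarIndex_le : weakStarIndex ParityRenorming ≤ 7 / 10 := by
  have hopen : ∀ (n : ℕ) (c : ℝ), IsOpen {w : WeakDual ℝ ParityRenorming | c < w (vec n)} :=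
    fun n c => isOpen_lt continuous_const (WeakDual.eval_continuous _)
  refine csInf_le (bddBelow_pos_and _) ⟨by norm_num, thinFunctional, norm_thinFunctional, _,
    ⟨_, (hopen 0 (74 / 100)).inter ((hopen 1 (24 / 100)).inter (hopen 2 (24 / 100))), rfl⟩,
    ⟨thinFunctional, by simpa using norm_thinFunctional_le, ?_⟩, ?_⟩
  · change 74 / 100 < thinFunctional (vec 0) ∧ 24 / 100 < thinFunctional (vec 1) ∧
      24 / 100 < thinFunctional (vec 2)
    simp only [thinFunctional_apply, coord_vec]
    norm_num
  · rintro f ⟨hf, h0, h1, h2⟩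
    change 74 / 100 < f (vec 0) at h0
    change 24 / 100 < f (vec 1) at h1
    change 24 / 100 < f (vec 2) at h2
    replace hf : ‖f‖ ≤ 1 := by simpa using hf
    have hcube : ∀ y : ParityRenorming, (∀ n, |coord n y| ≤ 1) → f y ≤ 5 / 4 := fun y hy => by
      have h3 := norm_le_of_abs_coord_le zero_le_one hy
      have h4 := (le_abs_self _).trans (f.le_of_opNorm_le hf y)
      linarith
    have hsum : f (vec 0) + f (vec 1) + f (vec 2) ≤ 5 / 4 := by
      rw [← map_add, ← map_add]
      refine hcube _ fun n => ?_
      simp only [map_add, coord_vec]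
      split_ifs <;> first | omega | norm_num
    rw [mem_closedBall_iff_norm]
    refine ContinuousLinearMap.opNorm_le_of_unit_norm (by norm_num) fun z hz => ?_
    have hz1 : ∀ n, |coord n z| ≤ 1 := fun n => (abs_coord_le n z).trans hz.le
    set w : ParityRenorming :=
      z - coord 0 z • vec 0 - coord 1 z • vec 1 - coord 2 z • vec 2 with hw
    have hwc : ∀ n, coord n w = if n = 0 ∨ n = 1 ∨ n = 2 then 0 else coord n z := by
      intro n
      rw [hw]
      simp only [map_sub, map_smul, coord_vec, smul_eq_mul]
      by_cases hn0 : n = 0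
      · subst hn0; norm_num
      by_cases hn1 : n = 1
      · subst hn1; norm_num
      by_cases hn2 : n = 2
      · subst hn2; norm_num
      simp [hn0, hn1, hn2]
    have htail : ∀ σ : ℝ, |σ| = 1 → f (vec 0) + f (vec 1) + f (vec 2) + σ * f w ≤ 5 / 4 := by
      intro σ hσ
      have := hcube (vec 0 + vec 1 + vec 2 + σ • w) fun n => by
        simp only [map_add, map_smul, coord_vec, hwc, smul_eq_mul]
        by_cases hn0 : n = 0
        · subst hn0; norm_num
        by_cases hn1 : n = 1
        · subst hn1; norm_num
        by_cases hn2 : n = 2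
        · subst hn2; norm_num
        simpa [hn0, hn1, hn2, abs_mul, hσ] using hz1 n
      simpa using this
    have hfw : |f w| ≤ 3 / 100 := by
      have h3 := htail 1 (by simp)
      have h4 := htail (-1) (by simp)
      rw [abs_le]
      constructor <;> linarith
    have hfz : f z = coord 0 z * f (vec 0) + coord 1 z * f (vec 1) + coord 2 z * f (vec 2) + f w := by
      rw [hw]
      simp only [map_sub, map_smul, smul_eq_mul]
      ring
    have heq : (f - thinFunctional) z = coord 0 z * (f (vec 0) - 3 / 4) +
        coord 1 z * (f (vec 1) - 1 / 4) + coord 2 z * (f (vec 2) - 1 / 4) + f w := by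
      rw [sub_apply, hfz, thinFunctional_apply]
      ring
    have hmul : ∀ {a b : ℝ}, |a| ≤ 1 → |b| ≤ 2 / 100 → |a * b| ≤ 2 / 100 := fun ha hb => by
      rw [abs_mul]
      exact (mul_le_of_le_one_left (abs_nonneg _) ha).trans hb
    -- Each of the three coefficients is bounded above through `hsum` and the lower bounds on the
    -- other two, for instance f(e₀) ≤ 1.25 - 0.48 = 0.77.
    have e0 := hmul (hz1 0) (b := f (vec 0) - 3 / 4) (by rw [abs_le]; constructor <;> linarith)
    have e1 := hmul (hz1 1) (b := f (vec 1) - 1 / 4) (by rw [abs_le]; constructor <;> linarith)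
    have e2 := hmul (hz1 2) (b := f (vec 2) - 1 / 4) (by rw [abs_le]; constructor <;> linarith)
    rw [heq, Real.norm_eq_abs]
    rw [abs_le] at e0 e1 e2 hfw ⊢
    constructor <;> linarith

end ParityRenorming

end Renorming

theorem isWeaklyCompact_smulRight {X Y : Type*} [NormedAddCommGroup X] [NormedSpace ℝ X]
    [NormedAddCommGroup Y] [NormedSpace ℝ Y] (f : StrongDual ℝ X) (y : Y) :
    IsWeaklyCompact (f.smulRight y) := by
  have hcont : Continuous fun t : ℝ => toWeakSpaceCLM ℝ Y (t • y) := by fun_prop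
  refine (isCompact_Icc.image hcont (s := Icc (-‖f‖) ‖f‖)).closure_of_subset ?_
  rintro _ ⟨_, ⟨x, hx, rfl⟩, rfl⟩
  refine ⟨f x, abs_le.1 ?_, rfl⟩
  simpa using f.le_opNorm_of_le (show ‖x‖ ≤ 1 by simpa using hx)

end DaugavetIndex

theorem proposition3p2 :
    (∀ (X : Type*) [NormedAddCommGroup X] [NormedSpace ℝ X] [CompleteSpace X]
      (T : X →L[ℝ] X), ‖T‖ = 1 → DaugavetIndex.IsWeaklyCompact T →
        max (DaugavetIndex.sliceIndex X) (DaugavetIndex.weakStarSliceIndex X)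
          ≤ ‖T + ContinuousLinearMap.id ℝ X‖) ∧
    (∃ (Z : Type) (_ : NormedAddCommGroup Z) (_ : NormedSpace ℝ Z) (_ : CompleteSpace Z),
      Nonempty (Z ≃L[ℝ] C₀(ℕ, ℝ)) ∧
        sInf {c : ℝ | ∃ T : Z →L[ℝ] Z, ‖T‖ = 1 ∧ DaugavetIndex.IsWeaklyCompact T ∧
            c = ‖T + ContinuousLinearMap.id ℝ Z‖}
          ≠ max (DaugavetIndex.index Z) (DaugavetIndex.weakStarIndex Z)) := by
  refine ⟨fun X _ _ _ T hT hTc => max_le (DaugavetIndex.sliceIndex_le_norm_add_id hT hTc)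
    (DaugavetIndex.weakStarSliceIndex_le_norm_add_id hT hTc),
    DaugavetIndex.ParityRenorming, inferInstance, inferInstance, inferInstance,
    ⟨DaugavetIndex.ParityRenorming.equivC0⟩, ne_of_gt ?_⟩
  refine (max_le DaugavetIndex.ParityRenorming.index_le
    DaugavetIndex.ParityRenorming.weakStarIndex_le).trans_lt
    (lt_of_lt_of_le (by norm_num : (7 / 10 : ℝ) < 4 / 5) (le_csInf ?_ ?_))
  -- A rank-one operator shows that the set is nonempty; otherwise its `sInf` would be the default
  -- value 0.
  · refine ⟨_, DaugavetIndex.ParityRenorming.thinFunctional.smulRight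
      DaugavetIndex.ParityRenorming.thinPoint, ?_, DaugavetIndex.isWeaklyCompact_smulRight _ _, rfl⟩
    rw [ContinuousLinearMap.norm_smulRight_apply, DaugavetIndex.ParityRenorming.norm_thinFunctional,
      DaugavetIndex.ParityRenorming.norm_thinPoint, mul_one]
  · rintro _ ⟨T, hT, hTc, rfl⟩
    exact DaugavetIndex.ParityRenorming.le_sliceIndex.trans
      (DaugavetIndex.sliceIndex_le_norm_add_id hT hTc)
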